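/- **Theorem (Hausdorff–Young–Paley inequality).** Let $1 < p \le 2$, let $p'$ be the conjugate exponent, $\frac1p + \frac1{p'} = 1$, and let $p \le b \le p'$. There is a constant $C > 0$ depending only on $p$ and $b$ such that the following holds for every $d$. Let $L$ be a lattice in $\mathbb{R}^d$ (a discrete subgroup spanned over $\mathbb{Z}$ by $d$ linearly independent vectors), let $L^\perp = \{\kappa \in \mathbb{R}^d : \kappa\cdot\lambda \in \mathbb{Z} \text{ for all } \lambda \in L\}$ be its dual lattice, and let $\Omega \subseteq \mathbb{R}^d$ be a fundamental domain of $L$, i.e. a Lebesgue measurable set that contains exactly one representative of every coset of $\mathbb{R}^d/L$. Let $\varphi : L^\perp \to (0,\infty)$ satisfy $$M_\varphi := \sup_{s>0}\, s\cdot \#\{\kappa \in L^\perp : \varphi(\kappa) \ge s\} < \infty .$$ Then for every $f \in L^p(\Omega)$ $$\Bigl(\sum_{\kappa\in L^\perp} \bigl|\widehat f(\kappa)\,\varphi(\kappa)^{\frac1b-\frac1{p'}}\bigr|^b\Bigr)^{1/b} \le C\, M_\varphi^{\frac1b-\frac1{p'}}\, \|f\|_{L^p(\Omega)},$$ where $$\widehat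 f(\kappa) = \frac1{|\Omega|}\int_\Omega f(x)\,e^{-2\pi i\kappa\cdot x}\,dx, \qquad \|f\|_{L^p(\Omega)} = \Bigl(\frac1{|\Omega|}\int_\Omega |f(x)|^p\,dx\Bigr)^{1/p}$$ and $|\Omega|$ is the Lebesgue measure of $\Omega$. -/

import Mathlib

open MeasureTheory
open scoped ENNReal NNReal InnerProductSpace

noncomputable section

namespace LatticeFourier

variable {d : ℕ}

/-- The dual lattice `L^⊥ = {κ ∈ ℝ^d | κ · l ∈ ℤ for all l ∈ L}`: Mathlib's dual submodule over `ℤ`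
for the Euclidean inner product. -/
def dualLattice (L : Submodule ℤ (EuclideanSpace ℝ (Fin d))) :
    Submodule ℤ (EuclideanSpace ℝ (Fin d)) :=
  LinearMap.BilinForm.dualSubmodule (innerₗ (EuclideanSpace ℝ (Fin d))) L

theorem mem_dualLattice {L : Submodule ℤ (EuclideanSpace ℝ (Fin d))}
    {κ : EuclideanSpace ℝ (Fin d)} :
    κ ∈ dualLattice L ↔ ∀ l ∈ L, ∃ n : ℤ, (n : ℝ) = ⟪κ, l⟫_ℝ := by
  simp [dualLattice, LinearMap.BilinForm.mem_dualSubmodule, Submodule.mem_one]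

/-- `Ω` is a fundamental domain of `L`: it is Lebesgue measurable, and every `x ∈ ℝ^d` has exactly
one translate by an element of `L` in `Ω`, that is, `∑_{l ∈ L} 1_Ω(x + l) = 1`. -/
structure IsLatticeFundamentalDomain (L : Submodule ℤ (EuclideanSpace ℝ (Fin d)))
    (Ω : Set (EuclideanSpace ℝ (Fin d))) : Prop where
  measurable : NullMeasurableSet Ω volume
  existsUnique_add_mem : ∀ x : EuclideanSpace ℝ (Fin d), ∃! l : L, x + (l : EuclideanSpace ℝ (Fin d)) ∈ Ω

/-- The Fourier coefficient `f̂(κ) = |Ω|⁻¹ ∫_Ω f(x) e^{-2πi κ·x} dx`. -/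
def coeff (Ω : Set (EuclideanSpace ℝ (Fin d))) (f : EuclideanSpace ℝ (Fin d) → ℂ)
    (κ : EuclideanSpace ℝ (Fin d)) : ℂ :=
  ((volume.real Ω : ℝ) : ℂ)⁻¹ *
    ∫ x in Ω, f x * Complex.exp (-2 * Real.pi * Complex.I * ((⟪κ, x⟫_ℝ : ℝ) : ℂ))

/-- The `L^p(Ω)` norm `(|Ω|⁻¹ ∫_Ω |f|^p dx)^{1/p}` with respect to normalized Lebesgue measure
on `Ω`. -/
def normLp (Ω : Set (EuclideanSpace ℝ (Fin d))) (p : ℝ) (f : EuclideanSpace ℝ (Fin d) → ℂ) :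
    ℝ≥0∞ :=
  eLpNorm f (ENNReal.ofReal p) ((volume Ω)⁻¹ • volume.restrict Ω)

/-- `M_φ = sup_{s > 0} s · #{κ | φ(κ) ≥ s}`, as an extended nonnegative number. -/
def levelSup {α : Type*} (φ : α → ℝ) : ℝ≥0∞ :=
  ⨆ (s : ℝ) (_ : 0 < s), ENNReal.ofReal s * (({κ | s ≤ φ κ}.encard : ℕ∞) : ℝ≥0∞)

end LatticeFourier

end

/-!
Write `T f` for the family of Fourier coefficients of `f`. Two bounds on `T` carry the whole
argument, `sup |T f| ≤ ‖f‖₁` and Bessel's inequality.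

Give the index set the measure with mass `φ(κ)²` at `κ`. Then `f ↦ |T f| / φ` is of strong type
`(2, 2)` by Bessel, and of weak type `(1, 1)` because `∑_{φ(κ) ≤ r} φ(κ)² ≤ 2 r M_φ`, so
interpolating between the two gives Paley's inequality
`∑ φ^(2 - p) |T f|^p ≤ K M_φ^(2 - p) ‖f‖_p^p`.

Any summable weight has `M_φ ≤ ∑ φ`. Paley's inequality with the weight `φ = |T f|^p'`, restricted
to finitely many indices, therefore bounds `∑ |T f|^p'` by a power of itself smaller than `1` times
`K ‖f‖_p^p`, which is the Hausdorff–Young inequality. Hölder's inequality interpolates between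
these two endpoints `b = p` and `b = p'`.
-/

theorem enorm_rpow_eq_ofReal {F : Type*} [SeminormedAddGroup F] (a : F) {s : ℝ} (hs : 0 ≤ s) :
    ‖a‖ₑ ^ s = ENNReal.ofReal (‖a‖ ^ s) := by
  rw [← ofReal_norm, ENNReal.ofReal_rpow_of_nonneg (norm_nonneg a) hs]

section Truncation

variable {X E : Type*} [NormedAddCommGroup E]

/-- The part of `f` above height `t`, i.e. `f` set to zero wherever `‖f‖ ≤ t`. It is the summand
controlled by the lower endpoint exponent in real interpolation. -/
noncomputable def highPart (f : X → E) (t : ℝ) : X → E := {x | t < ‖f x‖}.indicator f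

/-- The part of `f` below height `t`, i.e. `f` set to zero wherever `‖f‖ > t`. It is the summand
controlled by the upper endpoint exponent in real interpolation. -/
noncomputable def lowPart (f : X → E) (t : ℝ) : X → E := {x | t < ‖f x‖}ᶜ.indicator f

theorem highPart_add_lowPart (f : X → E) (t : ℝ) : highPart f t + lowPart f t = f :=
  Set.indicator_self_add_compl _ f

theorem enorm_highPart_rpow (f : X → E) (t : ℝ) {q : ℝ} (hq : 0 < q) (x : X) :
    ‖highPart f t x‖ₑ ^ q = (Set.Iio ‖f x‖).indicator (fun _ => ‖f x‖ₑ ^ q) t := by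
  by_cases h : t < ‖f x‖ <;> simp [highPart, h, hq]

theorem enorm_lowPart_rpow (f : X → E) (t : ℝ) {r : ℝ} (hr : 0 < r) (x : X) :
    ‖lowPart f t x‖ₑ ^ r = (Set.Ici ‖f x‖).indicator (fun _ => ‖f x‖ₑ ^ r) t := by
  by_cases h : t < ‖f x‖
  · simp [lowPart, h, hr]
  · simp [lowPart, h, not_lt.1 h]

theorem enorm_highPart_rpow_le (f : X → E) {t q p : ℝ} (ht : 0 < t) (hq : 0 < q) (hqp : q ≤ p)
    (x : X) : ‖highPart f t x‖ₑ ^ q ≤ ENNReal.ofReal (t ^ (q - p)) * ‖f x‖ₑ ^ p := by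
  rw [enorm_highPart_rpow f t hq]
  refine Set.indicator_apply_le' (fun htx : t < ‖f x‖ => ?_) fun _ => zero_le
  rw [enorm_rpow_eq_ofReal _ hq.le, enorm_rpow_eq_ofReal _ (hq.le.trans hqp),
    ← ENNReal.ofReal_mul (by positivity)]
  refine ENNReal.ofReal_le_ofReal ?_
  calc ‖f x‖ ^ q = ‖f x‖ ^ (q - p) * ‖f x‖ ^ p := by
        rw [← Real.rpow_add (ht.trans htx), sub_add_cancel]
    _ ≤ t ^ (q - p) * ‖f x‖ ^ p :=
        mul_le_mul_of_nonneg_right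
          (Real.rpow_le_rpow_of_nonpos ht htx.le (sub_nonpos.2 hqp)) (by positivity)

theorem enorm_lowPart_rpow_le (f : X → E) {t p r : ℝ} (hp : 0 < p) (hpr : p ≤ r)
    (x : X) : ‖lowPart f t x‖ₑ ^ r ≤ ENNReal.ofReal (t ^ (r - p)) * ‖f x‖ₑ ^ p := by
  rw [enorm_lowPart_rpow f t (hp.trans_le hpr)]
  refine Set.indicator_apply_le' (fun htx : ‖f x‖ ≤ t => ?_) fun _ => zero_le
  have ht : 0 ≤ t := (norm_nonneg _).trans htx
  rw [enorm_rpow_eq_ofReal _ hp.le, enorm_rpow_eq_ofReal _ (hp.le.trans hpr),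
    ← ENNReal.ofReal_mul (by positivity)]
  refine ENNReal.ofReal_le_ofReal ?_
  calc ‖f x‖ ^ r = ‖f x‖ ^ (r - p) * ‖f x‖ ^ p := by
        rw [← Real.rpow_add_of_nonneg (norm_nonneg _) (sub_nonneg.2 hpr) hp.le, sub_add_cancel]
    _ ≤ t ^ (r - p) * ‖f x‖ ^ p := by gcongr

theorem lintegral_ofReal_rpow_Ioo {a c : ℝ} (ha : 0 < a) (hc : 0 ≤ c) :
    ∫⁻ t in Set.Ioo 0 c, ENNReal.ofReal (t ^ (a - 1)) = ENNReal.ofReal (c ^ a / a) := by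
  rw [setLIntegral_congr (Ioo_ae_eq_Ioc (μ := volume)), ← ofReal_integral_eq_lintegral_ofReal]
  · rw [← intervalIntegral.integral_of_le hc, integral_rpow (Or.inl (by linarith)),
      sub_add_cancel, Real.zero_rpow ha.ne', sub_zero]
  · exact (intervalIntegral.intervalIntegrable_rpow' (by linarith)).1
  · filter_upwards [ae_restrict_mem measurableSet_Ioc] with t ht
    exact Real.rpow_nonneg ht.1.le _

theorem lintegral_ofReal_rpow_Ici {a c : ℝ} (ha : 0 < a) (hc : 0 < c) :
    ∫⁻ t in Set.Ici c, ENNReal.ofReal (t ^ (-a - 1)) = ENNReal.ofReal (c ^ (-a) / a) := by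
  rw [setLIntegral_congr (Ioi_ae_eq_Ici (μ := volume)).symm, ← ofReal_integral_eq_lintegral_ofReal]
  · rw [integral_Ioi_rpow_of_lt (by linarith) hc, sub_add_cancel, neg_div_neg_eq]
  · exact integrableOn_Ioi_rpow_of_lt (by linarith) hc
  · filter_upwards [ae_restrict_mem measurableSet_Ioi] with t ht
    exact Real.rpow_nonneg (hc.trans ht).le _

theorem lintegral_rpow_mul_enorm_highPart (f : X → E) {q p : ℝ} (hq : 0 < q) (hqp : q < p)
    (x : X) :
    ∫⁻ t in Set.Ioi (0 : ℝ), ENNReal.ofReal (t ^ (p - q - 1)) * ‖highPart f t x‖ₑ ^ q =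
      ENNReal.ofReal (1 / (p - q)) * ‖f x‖ₑ ^ p := by
  have hpq : 0 < p - q := sub_pos.2 hqp
  simp only [enorm_highPart_rpow f _ hq,
    ← Set.indicator_mul_right _ fun t : ℝ => ENNReal.ofReal (t ^ (p - q - 1))]
  rw [setLIntegral_indicator measurableSet_Iio, Set.inter_comm, Set.Ioi_inter_Iio,
    lintegral_mul_const' _ _ (by finiteness), lintegral_ofReal_rpow_Ioo hpq (norm_nonneg _),
    enorm_rpow_eq_ofReal _ hq.le, enorm_rpow_eq_ofReal _ (hq.trans hqp).le,
    ← ENNReal.ofReal_mul (by positivity), ← ENNReal.ofReal_mul (by positivity)]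
  congr 1
  calc ‖f x‖ ^ (p - q) / (p - q) * ‖f x‖ ^ q
      = 1 / (p - q) * (‖f x‖ ^ (p - q) * ‖f x‖ ^ q) := by ring
    _ = 1 / (p - q) * ‖f x‖ ^ p := by
        rw [← Real.rpow_add_of_nonneg (norm_nonneg _) hpq.le hq.le, sub_add_cancel]

theorem lintegral_rpow_mul_enorm_lowPart (f : X → E) {p r : ℝ} (hp : 0 < p) (hpr : p < r)
    (x : X) :
    ∫⁻ t in Set.Ioi (0 : ℝ), ENNReal.ofReal (t ^ (p - r - 1)) * ‖lowPart f t x‖ₑ ^ r =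
      ENNReal.ofReal (1 / (r - p)) * ‖f x‖ₑ ^ p := by
  have hr : 0 < r := hp.trans hpr
  have hrp : 0 < r - p := sub_pos.2 hpr
  simp only [enorm_lowPart_rpow f _ hr,
    ← Set.indicator_mul_right _ fun t : ℝ => ENNReal.ofReal (t ^ (p - r - 1))]
  obtain hfx | hfx := (norm_nonneg (f x)).eq_or_lt'
  · simp [norm_eq_zero.1 hfx, hp, hr]
  rw [setLIntegral_indicator measurableSet_Ici,
    Set.inter_eq_left.2 (Set.Ici_subset_Ioi.2 hfx),
    lintegral_mul_const' _ _ (by finiteness), ← neg_sub r p, lintegral_ofReal_rpow_Ici hrp hfx,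
    enorm_rpow_eq_ofReal _ hr.le, enorm_rpow_eq_ofReal _ hp.le,
    ← ENNReal.ofReal_mul (by positivity), ← ENNReal.ofReal_mul (by positivity)]
  congr 1
  calc ‖f x‖ ^ (-(r - p)) / (r - p) * ‖f x‖ ^ r
      = 1 / (r - p) * (‖f x‖ ^ (-(r - p)) * ‖f x‖ ^ r) := by ring
    _ = 1 / (r - p) * ‖f x‖ ^ p := by rw [← Real.rpow_add hfx]; congr 2; ring

variable [MeasurableSpace X] {μ : Measure X} {f : X → E}

theorem nullMeasurableSet_lt_norm (hf : AEStronglyMeasurable f μ) (t : ℝ) :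
    NullMeasurableSet {x | t < ‖f x‖} μ :=
  nullMeasurableSet_lt aemeasurable_const hf.norm.aemeasurable

theorem memLp_of_enorm_rpow_le {g : X → E} {p q : ℝ} (hq : 0 < q) (hp : 0 < p)
    (hg : AEStronglyMeasurable g μ) (hf : MemLp f (ENNReal.ofReal p) μ) {c : ℝ≥0∞} (hc : c ≠ ∞)
    (hgf : ∀ x, ‖g x‖ₑ ^ q ≤ c * ‖f x‖ₑ ^ p) : MemLp g (ENNReal.ofReal q) μ := by
  refine ⟨hg, ?_⟩
  have hfin := hf.2
  rw [eLpNorm_lt_top_iff_lintegral_rpow_enorm_lt_top (by simpa) (by simp),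
    ENNReal.toReal_ofReal hp.le] at hfin
  rw [eLpNorm_lt_top_iff_lintegral_rpow_enorm_lt_top (by simpa) (by simp),
    ENNReal.toReal_ofReal hq.le]
  calc ∫⁻ x, ‖g x‖ₑ ^ q ∂μ ≤ ∫⁻ x, c * ‖f x‖ₑ ^ p ∂μ := lintegral_mono hgf
    _ = c * ∫⁻ x, ‖f x‖ₑ ^ p ∂μ := lintegral_const_mul' _ _ hc
    _ < ∞ := ENNReal.mul_lt_top hc.lt_top hfin

theorem memLp_highPart {t q p : ℝ} (hf : MemLp f (ENNReal.ofReal p) μ) (ht : 0 < t)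
    (hq : 0 < q) (hqp : q ≤ p) : MemLp (highPart f t) (ENNReal.ofReal q) μ :=
  memLp_of_enorm_rpow_le hq (hq.trans_le hqp)
    (hf.1.indicator₀ (nullMeasurableSet_lt_norm hf.1 t)) hf ENNReal.ofReal_ne_top
    (enorm_highPart_rpow_le f ht hq hqp)

theorem memLp_lowPart {p r : ℝ} (hf : MemLp f (ENNReal.ofReal p) μ) (t : ℝ)
    (hp : 0 < p) (hpr : p ≤ r) : MemLp (lowPart f t) (ENNReal.ofReal r) μ :=
  memLp_of_enorm_rpow_le (hp.trans_le hpr) hp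
    (hf.1.indicator₀ (nullMeasurableSet_lt_norm hf.1 t).compl) hf ENNReal.ofReal_ne_top
    (enorm_lowPart_rpow_le f hp hpr)

theorem aestronglyMeasurable_uncurry_highPart (ρ : Measure ℝ) [SFinite μ]
    (hf : AEStronglyMeasurable f μ) :
    AEStronglyMeasurable (fun z : ℝ × X => highPart f z.1 z.2) (ρ.prod μ) :=
  hf.comp_snd.indicator₀
    (nullMeasurableSet_lt measurable_fst.aemeasurable hf.norm.aemeasurable.comp_snd)

theorem aestronglyMeasurable_uncurry_lowPart (ρ : Measure ℝ) [SFinite μ]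
    (hf : AEStronglyMeasurable f μ) :
    AEStronglyMeasurable (fun z : ℝ × X => lowPart f z.1 z.2) (ρ.prod μ) :=
  hf.comp_snd.indicator₀
    (nullMeasurableSet_lt measurable_fst.aemeasurable hf.norm.aemeasurable.comp_snd).compl

theorem lintegral_rpow_mul_lintegral_highPart [SFinite μ] (hf : AEStronglyMeasurable f μ)
    {q p : ℝ} (hq : 0 < q) (hqp : q < p) :
    ∫⁻ t in Set.Ioi (0 : ℝ), ENNReal.ofReal (t ^ (p - q - 1)) * ∫⁻ x, ‖highPart f t x‖ₑ ^ q ∂μ =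
      ENNReal.ofReal (1 / (p - q)) * ∫⁻ x, ‖f x‖ₑ ^ p ∂μ := by
  simp_rw [← lintegral_const_mul' _ _ ENNReal.ofReal_ne_top]
  rw [lintegral_lintegral_swap]
  · simp_rw [lintegral_rpow_mul_enorm_highPart f hq hqp]
  · exact AEMeasurable.mul (by fun_prop)
      ((aestronglyMeasurable_uncurry_highPart _ hf).enorm.pow_const q)

theorem lintegral_rpow_mul_lintegral_lowPart [SFinite μ] (hf : AEStronglyMeasurable f μ)
    {p r : ℝ} (hp : 0 < p) (hpr : p < r) :
    ∫⁻ t in Set.Ioi (0 : ℝ), ENNReal.ofReal (t ^ (p - r - 1)) * ∫⁻ x, ‖lowPart f t x‖ₑ ^ r ∂μ =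
      ENNReal.ofReal (1 / (r - p)) * ∫⁻ x, ‖f x‖ₑ ^ p ∂μ := by
  simp_rw [← lintegral_const_mul' _ _ ENNReal.ofReal_ne_top]
  rw [lintegral_lintegral_swap]
  · simp_rw [lintegral_rpow_mul_enorm_lowPart f hp hpr]
  · exact AEMeasurable.mul (by fun_prop)
      ((aestronglyMeasurable_uncurry_lowPart _ hf).enorm.pow_const r)

end Truncation

section Marcinkiewicz

variable {X Y E F : Type*} [MeasurableSpace X] [MeasurableSpace Y] [NormedAddCommGroup E]
  [SeminormedAddGroup F] {T : (X → E) → Y → F} {μ : Measure X} {ν : Measure Y}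

/-- The operator `T` is of weak type `(q, q)`: `ν {‖T f‖ ≥ t} ≤ A t^{-q} ‖f‖_q^q`. The constant `A`
is the `q`-th power of the usual weak-type norm, and `T` need not be linear. -/
def HasWeakType (T : (X → E) → Y → F) (q : ℝ) (A : ℝ≥0∞) (μ : Measure X) (ν : Measure Y) : Prop :=
  ∀ f, MemLp f (ENNReal.ofReal q) μ → ∀ t : ℝ, 0 < t →
    ν {y | t ≤ ‖T f y‖} ≤ A * ENNReal.ofReal (t ^ (-q)) * ∫⁻ x, ‖f x‖ₑ ^ q ∂μ

theorem HasWeakType.of_lintegral_rpow_le {q : ℝ} {A : ℝ≥0∞} (hq : 0 ≤ q)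
    (hmeas : ∀ f, MemLp f (ENNReal.ofReal q) μ → AEMeasurable (fun y => ‖T f y‖ₑ) ν)
    (hT : ∀ f, MemLp f (ENNReal.ofReal q) μ →
      ∫⁻ y, ‖T f y‖ₑ ^ q ∂ν ≤ A * ∫⁻ x, ‖f x‖ₑ ^ q ∂μ) :
    HasWeakType T q A μ ν := by
  intro f hf t ht
  have hsub : {y | t ≤ ‖T f y‖} ⊆ {y | ENNReal.ofReal (t ^ q) ≤ ‖T f y‖ₑ ^ q} := fun y hy => by
    rw [Set.mem_ofPred_eq, enorm_rpow_eq_ofReal _ hq]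
    exact ENNReal.ofReal_le_ofReal (Real.rpow_le_rpow ht.le hy hq)
  have htq : 0 < t ^ q := Real.rpow_pos_of_pos ht q
  calc ν {y | t ≤ ‖T f y‖}
      ≤ ν {y | ENNReal.ofReal (t ^ q) ≤ ‖T f y‖ₑ ^ q} := measure_mono hsub
    _ ≤ (∫⁻ y, ‖T f y‖ₑ ^ q ∂ν) / ENNReal.ofReal (t ^ q) :=
        meas_ge_le_lintegral_div ((hmeas f hf).pow_const q) (by simpa) (by simp)
    _ ≤ (A * ∫⁻ x, ‖f x‖ₑ ^ q ∂μ) / ENNReal.ofReal (t ^ q) := by gcongr; exact hT f hf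
    _ = A * ENNReal.ofReal (t ^ (-q)) * ∫⁻ x, ‖f x‖ₑ ^ q ∂μ := by
        rw [Real.rpow_neg ht.le, ENNReal.ofReal_inv_of_pos htq, div_eq_mul_inv]
        ring

variable {q p r : ℝ} {A B : ℝ≥0∞} {f : X → E}

theorem HasWeakType.measure_mul_rpow_le (hq : HasWeakType T q A μ ν) {g : X → E}
    (hg : MemLp g (ENNReal.ofReal q) μ) {t : ℝ} (ht : 0 < t) (p : ℝ) :
    ν {y | t / 2 ≤ ‖T g y‖} * ENNReal.ofReal (t ^ (p - 1)) ≤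
      A * ENNReal.ofReal (2 ^ q) *
        (ENNReal.ofReal (t ^ (p - q - 1)) * ∫⁻ x, ‖g x‖ₑ ^ q ∂μ) := by
  have hpow : (t / 2) ^ (-q) * t ^ (p - 1) = 2 ^ q * t ^ (p - q - 1) := by
    rw [div_eq_inv_mul, Real.mul_rpow (by positivity) ht.le, Real.inv_rpow two_pos.le,
      Real.rpow_neg two_pos.le, inv_inv, mul_assoc, ← Real.rpow_add ht]
    congr 2
    ring
  calc ν {y | t / 2 ≤ ‖T g y‖} * ENNReal.ofReal (t ^ (p - 1))
      ≤ A * ENNReal.ofReal ((t / 2) ^ (-q)) * (∫⁻ x, ‖g x‖ₑ ^ q ∂μ) *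
          ENNReal.ofReal (t ^ (p - 1)) := by gcongr; exact hq g hg (t / 2) (half_pos ht)
    _ = A * ENNReal.ofReal ((t / 2) ^ (-q) * t ^ (p - 1)) * ∫⁻ x, ‖g x‖ₑ ^ q ∂μ := by
        rw [ENNReal.ofReal_mul (by positivity)]
        ring
    _ = A * ENNReal.ofReal (2 ^ q) *
          (ENNReal.ofReal (t ^ (p - q - 1)) * ∫⁻ x, ‖g x‖ₑ ^ q ∂μ) := by
        rw [hpow, ENNReal.ofReal_mul (by positivity)]
        ring

theorem HasWeakType.measure_norm_mul_rpow_le (hA : HasWeakType T q A μ ν)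
    (hB : HasWeakType T r B μ ν) (hq : 0 < q) (hqp : q ≤ p) (hpr : p ≤ r)
    (hT : ∀ g h, MemLp g (ENNReal.ofReal q) μ → MemLp h (ENNReal.ofReal r) μ →
      ∀ y, ‖T (g + h) y‖ ≤ ‖T g y‖ + ‖T h y‖)
    (hf : MemLp f (ENNReal.ofReal p) μ) {t : ℝ} (ht : 0 < t) :
    ν {y | t ≤ ‖T f y‖} * ENNReal.ofReal (t ^ (p - 1)) ≤
      A * ENNReal.ofReal (2 ^ q) *
          (ENNReal.ofReal (t ^ (p - q - 1)) * ∫⁻ x, ‖highPart f t x‖ₑ ^ q ∂μ) +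
        B * ENNReal.ofReal (2 ^ r) *
          (ENNReal.ofReal (t ^ (p - r - 1)) * ∫⁻ x, ‖lowPart f t x‖ₑ ^ r ∂μ) := by
  have hhigh := memLp_highPart hf ht hq hqp
  have hlow := memLp_lowPart hf t (hq.trans_le hqp) hpr
  have hsub : {y | t ≤ ‖T f y‖} ⊆
      {y | t / 2 ≤ ‖T (highPart f t) y‖} ∪ {y | t / 2 ≤ ‖T (lowPart f t) y‖} := by
    intro y (hy : t ≤ ‖T f y‖)
    have hadd := hT _ _ hhigh hlow y
    rw [highPart_add_lowPart] at hadd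
    by_contra! hcon
    simp only [Set.mem_union, Set.mem_ofPred_eq, not_or, not_le] at hcon
    linarith [hcon.1, hcon.2]
  calc ν {y | t ≤ ‖T f y‖} * ENNReal.ofReal (t ^ (p - 1))
      ≤ (ν {y | t / 2 ≤ ‖T (highPart f t) y‖} + ν {y | t / 2 ≤ ‖T (lowPart f t) y‖}) *
          ENNReal.ofReal (t ^ (p - 1)) := by
        gcongr
        exact (measure_mono hsub).trans (measure_union_le _ _)
    _ ≤ _ := by
        rw [add_mul]
        exact add_le_add (hA.measure_mul_rpow_le hhigh ht p) (hB.measure_mul_rpow_le hlow ht p)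

/-- **Marcinkiewicz interpolation theorem**. -/
theorem HasWeakType.lintegral_rpow_le [SFinite μ] (hA : HasWeakType T q A μ ν)
    (hB : HasWeakType T r B μ ν) (hq : 0 < q) (hqp : q < p) (hpr : p < r)
    (hT : ∀ g h, MemLp g (ENNReal.ofReal q) μ → MemLp h (ENNReal.ofReal r) μ →
      ∀ y, ‖T (g + h) y‖ ≤ ‖T g y‖ + ‖T h y‖)
    (hf : MemLp f (ENNReal.ofReal p) μ) (hTf : AEMeasurable (fun y => ‖T f y‖) ν) :
    ∫⁻ y, ‖T f y‖ₑ ^ p ∂ν ≤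
      ENNReal.ofReal p * (A * ENNReal.ofReal (2 ^ q / (p - q)) +
        B * ENNReal.ofReal (2 ^ r / (r - p))) * ∫⁻ x, ‖f x‖ₑ ^ p ∂μ := by
  have hp : 0 < p := hq.trans hqp
  have hhigh : AEMeasurable (fun t => ENNReal.ofReal (t ^ (p - q - 1)) *
      ∫⁻ x, ‖highPart f t x‖ₑ ^ q ∂μ) (volume.restrict (Set.Ioi 0)) :=
    AEMeasurable.mul (by fun_prop)
      ((aestronglyMeasurable_uncurry_highPart _ hf.1).enorm.pow_const q).lintegral_prod_right'
  have hlow : AEMeasurable (fun t => ENNReal.ofReal (t ^ (p - r - 1)) *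
      ∫⁻ x, ‖lowPart f t x‖ₑ ^ r ∂μ) (volume.restrict (Set.Ioi 0)) :=
    AEMeasurable.mul (by fun_prop)
      ((aestronglyMeasurable_uncurry_lowPart _ hf.1).enorm.pow_const r).lintegral_prod_right'
  simp_rw [enorm_rpow_eq_ofReal (F := F) _ hp.le]
  rw [lintegral_rpow_eq_lintegral_meas_le_mul ν (Filter.Eventually.of_forall fun _ => norm_nonneg _)
    hTf hp, mul_assoc]
  gcongr
  calc ∫⁻ t in Set.Ioi (0 : ℝ), ν {y | t ≤ ‖T f y‖} * ENNReal.ofReal (t ^ (p - 1))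
      ≤ ∫⁻ t in Set.Ioi (0 : ℝ), (A * ENNReal.ofReal (2 ^ q) *
          (ENNReal.ofReal (t ^ (p - q - 1)) * ∫⁻ x, ‖highPart f t x‖ₑ ^ q ∂μ) +
        B * ENNReal.ofReal (2 ^ r) *
          (ENNReal.ofReal (t ^ (p - r - 1)) * ∫⁻ x, ‖lowPart f t x‖ₑ ^ r ∂μ)) :=
        setLIntegral_mono' measurableSet_Ioi fun t ht =>
          hA.measure_norm_mul_rpow_le hB hq hqp.le hpr.le hT hf ht
    _ = A * ENNReal.ofReal (2 ^ q) * (ENNReal.ofReal (1 / (p - q)) * ∫⁻ x, ‖f x‖ₑ ^ p ∂μ) +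
        B * ENNReal.ofReal (2 ^ r) * (ENNReal.ofReal (1 / (r - p)) * ∫⁻ x, ‖f x‖ₑ ^ p ∂μ) := by
        rw [lintegral_add_left' (hhigh.const_mul _), lintegral_const_mul'' _ hhigh,
          lintegral_const_mul'' _ hlow, lintegral_rpow_mul_lintegral_highPart hf.1 hq hqp,
          lintegral_rpow_mul_lintegral_lowPart hf.1 hp hpr]
    _ = (A * ENNReal.ofReal (2 ^ q / (p - q)) + B * ENNReal.ofReal (2 ^ r / (r - p))) *
          ∫⁻ x, ‖f x‖ₑ ^ p ∂μ := by
        rw [div_eq_mul_one_div (2 ^ q), div_eq_mul_one_div (2 ^ r),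
          ENNReal.ofReal_mul (by positivity), ENNReal.ofReal_mul (by positivity)]
        ring

end Marcinkiewicz

section LevelSup

open LatticeFourier

variable {ι : Type*}

theorem levelSup_const_mul_le (φ : ι → ℝ) {c : ℝ} (hc : 0 < c) :
    levelSup (fun κ => c * φ κ) ≤ ENNReal.ofReal c * levelSup φ := by
  refine iSup₂_le fun s hs => ?_
  have hset : {κ | s ≤ c * φ κ} = {κ | s / c ≤ φ κ} := by
    ext κ
    simp only [Set.mem_ofPred_eq, div_le_iff₀' hc]
  calc ENNReal.ofReal s * ({κ | s ≤ c * φ κ}.encard : ℝ≥0∞)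
      = ENNReal.ofReal c * (ENNReal.ofReal (s / c) * ({κ | s / c ≤ φ κ}.encard : ℝ≥0∞)) := by
        rw [hset, ← mul_assoc, ← ENNReal.ofReal_mul hc.le, mul_div_cancel₀ _ hc.ne']
    _ ≤ ENNReal.ofReal c * levelSup φ := by
        gcongr
        exact le_iSup₂_of_le (s / c) (by positivity) le_rfl

theorem ofReal_le_levelSup (φ : ι → ℝ) (κ : ι) : ENNReal.ofReal (φ κ) ≤ levelSup φ := by
  obtain hκ | hκ := le_or_gt (φ κ) 0
  · simp [ENNReal.ofReal_of_nonpos hκ]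
  refine le_iSup₂_of_le (φ κ) hκ (le_mul_of_one_le_right zero_le ?_)
  have hmem : κ ∈ {κ' | φ κ ≤ φ κ'} := le_refl (φ κ)
  exact_mod_cast Set.one_le_encard_iff_nonempty.2 ⟨κ, hmem⟩

theorem levelSup_eq_iSup_count [MeasurableSpace ι] [DiscreteMeasurableSpace ι] (φ : ι → ℝ) :
    levelSup φ = ⨆ (s : ℝ) (_ : 0 < s), ENNReal.ofReal s * Measure.count {κ | s ≤ φ κ} := by
  simp only [levelSup, Measure.count_apply (MeasurableSet.of_discrete)]

theorem levelSup_le_tsum (φ : ι → ℝ≥0) : levelSup (fun κ => (φ κ : ℝ)) ≤ ∑' κ, (φ κ : ℝ≥0∞) := by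
  let _ : MeasurableSpace ι := ⊤
  rw [levelSup_eq_iSup_count, ← lintegral_count]
  refine iSup₂_le fun s _ => ?_
  simpa only [ENNReal.ofReal_le_coe] using mul_meas_ge_le_lintegral (μ := Measure.count)
    (f := fun κ => (φ κ : ℝ≥0∞)) Measurable.of_discrete (ENNReal.ofReal s)

variable [MeasurableSpace ι] [DiscreteMeasurableSpace ι]

theorem count_inter_le_mul_rpow_le (φ : ι → ℝ) (a r : ℝ) {t : ℝ} (ht : 0 < t) :
    Measure.count ({κ | t ≤ φ κ} ∩ {κ | φ κ ≤ r}) * ENNReal.ofReal (t ^ (a - 1)) ≤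
      (Set.Iic r).indicator (fun t => ENNReal.ofReal (t ^ (a - 1 - 1)) * levelSup φ) t := by
  obtain htr | htr := le_or_gt t r
  · rw [Set.indicator_of_mem (Set.mem_Iic.2 htr), levelSup_eq_iSup_count]
    calc Measure.count ({κ | t ≤ φ κ} ∩ {κ | φ κ ≤ r}) * ENNReal.ofReal (t ^ (a - 1))
        ≤ Measure.count {κ | t ≤ φ κ} * ENNReal.ofReal (t ^ (a - 1 - 1) * t) := by
          rw [← Real.rpow_add_one ht.ne', sub_add_cancel]
          gcongr
          exact Set.inter_subset_left
      _ = ENNReal.ofReal (t ^ (a - 1 - 1)) *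
            (ENNReal.ofReal t * Measure.count {κ | t ≤ φ κ}) := by
          rw [ENNReal.ofReal_mul (by positivity)]
          ring
      _ ≤ _ := by
          gcongr
          exact le_iSup₂_of_le t ht le_rfl
  · have hempty : {κ | t ≤ φ κ} ∩ {κ | φ κ ≤ r} = ∅ :=
      Set.eq_empty_of_forall_notMem fun κ hκ => (htr.trans_le hκ.1).not_ge hκ.2
    simp [hempty]

theorem setLIntegral_rpow_le_levelSup (φ : ι → ℝ≥0) {a r : ℝ} (ha : 1 < a) (hr : 0 ≤ r) :
    ∫⁻ κ in {κ | (φ κ : ℝ) ≤ r}, (φ κ : ℝ≥0∞) ^ a ∂Measure.count ≤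
      ENNReal.ofReal (a / (a - 1) * r ^ (a - 1)) * levelSup (fun κ => (φ κ : ℝ)) := by
  have ha0 : 0 < a := one_pos.trans ha
  calc ∫⁻ κ in {κ | (φ κ : ℝ) ≤ r}, (φ κ : ℝ≥0∞) ^ a ∂Measure.count
      = ∫⁻ κ in {κ | (φ κ : ℝ) ≤ r}, ENNReal.ofReal ((φ κ : ℝ) ^ a) ∂Measure.count := by
        simp_rw [← ENNReal.ofReal_rpow_of_nonneg NNReal.zero_le_coe ha0.le,
          ENNReal.ofReal_coe_nnreal]
    _ ≤ ENNReal.ofReal a * ∫⁻ t in Set.Ioi (0 : ℝ), (Set.Iic r).indicator (fun t =>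
          ENNReal.ofReal (t ^ (a - 1 - 1)) * levelSup (fun κ => (φ κ : ℝ))) t := by
        rw [lintegral_rpow_eq_lintegral_meas_le_mul _
          (Filter.Eventually.of_forall fun κ => (φ κ).coe_nonneg)
          Measurable.of_discrete.aemeasurable ha0]
        gcongr 1
        refine setLIntegral_mono' measurableSet_Ioi fun t ht => ?_
        rw [Measure.restrict_apply MeasurableSet.of_discrete]
        exact count_inter_le_mul_rpow_le _ a r ht
    _ = ENNReal.ofReal (a / (a - 1) * r ^ (a - 1)) * levelSup (fun κ => (φ κ : ℝ)) := by
        rw [setLIntegral_indicator measurableSet_Iic, Set.inter_comm, Set.Ioi_inter_Iic,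
          lintegral_mul_const _ (by fun_prop), ← setLIntegral_congr (Ioo_ae_eq_Ioc (μ := volume)),
          lintegral_ofReal_rpow_Ioo (sub_pos.2 ha) hr, ← mul_assoc, ← ENNReal.ofReal_mul ha0.le]
        congr 2
        ring

end LevelSup

section Paley

open LatticeFourier

variable {X ι E F : Type*} [SeminormedAddGroup F] {T : (X → E) → ι → F} {f : X → E} {p : ℝ}

/-- The quotients `‖T f κ‖ / φ κ` that Paley's inequality interpolates, with value `0` where
`φ κ = 0`. They are coerced to `ℝ` so as to be the values of an operator between normed spaces. -/
noncomputable def weightedQuotient (T : (X → E) → ι → F) (φ : ι → ℝ≥0) (f : X → E) (κ : ι) : ℝ :=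
  (‖T f κ‖₊ / φ κ : ℝ≥0)

theorem norm_weightedQuotient (T : (X → E) → ι → F) (φ : ι → ℝ≥0) (f : X → E) (κ : ι) :
    ‖weightedQuotient T φ f κ‖ = ‖T f κ‖ / φ κ :=
  NNReal.norm_eq _

theorem enorm_weightedQuotient (φ : ι → ℝ≥0) (κ : ι) :
    ‖weightedQuotient T φ f κ‖ₑ = (‖T f κ‖₊ / φ κ : ℝ≥0) := by
  rw [weightedQuotient, Real.enorm_of_nonneg NNReal.zero_le_coe, ENNReal.ofReal_coe_nnreal]

theorem rpow_mul_enorm_weightedQuotient_rpow (φ : ι → ℝ≥0) (hp : 0 ≤ p) (hp2 : p < 2) (κ : ι) :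
    (φ κ : ℝ≥0∞) ^ (2 : ℝ) * ‖weightedQuotient T φ f κ‖ₑ ^ p =
      (φ κ : ℝ≥0∞) ^ (2 - p) * ‖T f κ‖ₑ ^ p := by
  rw [enorm_weightedQuotient]
  obtain h | h := eq_or_ne (φ κ) 0
  · simp [h, hp2]
  · rw [ENNReal.coe_div h, ENNReal.div_rpow_of_nonneg _ _ hp,
      ENNReal.rpow_sub _ _ (by simpa) ENNReal.coe_ne_top, div_eq_mul_inv, div_eq_mul_inv,
      enorm_eq_nnnorm]
    ring

theorem rpow_two_mul_enorm_weightedQuotient_le (φ : ι → ℝ≥0) (κ : ι) :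
    (φ κ : ℝ≥0∞) ^ (2 : ℝ) * ‖weightedQuotient T φ f κ‖ₑ ^ (2 : ℝ) ≤ ‖T f κ‖ₑ ^ (2 : ℝ) := by
  rw [enorm_weightedQuotient, ← ENNReal.mul_rpow_of_nonneg _ _ two_pos.le, ← ENNReal.coe_mul,
    enorm_eq_nnnorm]
  gcongr
  obtain h | h := eq_or_ne (φ κ) 0
  · simp [h]
  · exact (mul_div_cancel₀ _ h).le

/-- The measure with mass `φ(κ)²` at `κ`. With respect to it the quotients `T f / φ` satisfy
endpoint bounds at both exponents `1` and `2`. -/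
noncomputable def paleyMeasure [MeasurableSpace ι] (φ : ι → ℝ≥0) : Measure ι :=
  Measure.count.withDensity fun κ => (φ κ : ℝ≥0∞) ^ (2 : ℝ)

theorem lintegral_paleyMeasure [MeasurableSpace ι] [DiscreteMeasurableSpace ι] (φ : ι → ℝ≥0)
    (g : ι → ℝ≥0∞) :
    ∫⁻ κ, g κ ∂paleyMeasure φ = ∑' κ, (φ κ : ℝ≥0∞) ^ (2 : ℝ) * g κ := by
  rw [paleyMeasure, lintegral_withDensity_eq_lintegral_mul _ Measurable.of_discrete
    Measurable.of_discrete, lintegral_count]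
  rfl

variable [MeasurableSpace X] [NormedAddCommGroup E] {μ : Measure X}

/-- `T` assigns to functions families of coefficients obeying the trivial bound
`sup_κ ‖T f κ‖ ≤ ‖f‖₁` and Bessel's inequality `∑_κ ‖T f κ‖² ≤ ‖f‖₂²`. Subadditivity across
`L¹ + L²` replaces linearity, as this is all that real interpolation asks for. -/
structure IsBesselMap (μ : Measure X) (T : (X → E) → ι → F) : Prop where
  norm_map_add_le : ∀ g h, Integrable g μ → MemLp h 2 μ → ∀ κ, ‖T (g + h) κ‖ ≤ ‖T g κ‖ + ‖T h κ‖
  enorm_le : ∀ g, Integrable g μ → ∀ κ, ‖T g κ‖ₑ ≤ ∫⁻ x, ‖g x‖ₑ ∂μ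
  tsum_sq_le : ∀ h, MemLp h 2 μ → ∑' κ, ‖T h κ‖ₑ ^ (2 : ℝ) ≤ ∫⁻ x, ‖h x‖ₑ ^ (2 : ℝ) ∂μ

theorem IsBesselMap.weightedQuotient_add_le (hT : IsBesselMap μ T) (φ : ι → ℝ≥0) {g h : X → E}
    (hg : Integrable g μ) (hh : MemLp h 2 μ) (κ : ι) :
    ‖weightedQuotient T φ (g + h) κ‖ ≤ ‖weightedQuotient T φ g κ‖ + ‖weightedQuotient T φ h κ‖ := by
  simp only [weightedQuotient, NNReal.norm_eq]
  rw [← NNReal.coe_add, NNReal.coe_le_coe, ← add_div]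
  gcongr
  exact hT.norm_map_add_le g h hg hh κ

section WeakType

variable [MeasurableSpace ι] [DiscreteMeasurableSpace ι]

theorem IsBesselMap.hasWeakType_one (hT : IsBesselMap μ T) (φ : ι → ℝ≥0) :
    HasWeakType (weightedQuotient T φ) 1 (2 * levelSup fun κ => (φ κ : ℝ)) μ (paleyMeasure φ) := by
  intro f hf t ht
  rw [ENNReal.ofReal_one, memLp_one_iff_integrable] at hf
  simp only [ENNReal.rpow_one, Real.rpow_neg_one]
  set N := ∫⁻ x, ‖f x‖ₑ ∂μ
  have hN_top : N ≠ ∞ := hf.2.ne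
  have hsub : {κ | t ≤ ‖weightedQuotient T φ f κ‖} ⊆ {κ | (φ κ : ℝ) ≤ N.toReal / t} := by
    intro κ (hκ : t ≤ ‖weightedQuotient T φ f κ‖)
    have hTf : ‖T f κ‖ ≤ N.toReal := by
      rw [← toReal_enorm]
      exact ENNReal.toReal_mono hN_top (hT.enorm_le f hf κ)
    rw [norm_weightedQuotient] at hκ
    have hφ : 0 < (φ κ : ℝ) := (φ κ).coe_nonneg.lt_of_ne' fun h => by simp [h, ht.not_ge] at hκ
    rw [le_div_iff₀ hφ] at hκ
    rw [Set.mem_ofPred_eq, le_div_iff₀' ht]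
    exact hκ.trans hTf
  calc paleyMeasure φ {κ | t ≤ ‖weightedQuotient T φ f κ‖}
      ≤ ∫⁻ κ in {κ | (φ κ : ℝ) ≤ N.toReal / t}, (φ κ : ℝ≥0∞) ^ (2 : ℝ) ∂Measure.count := by
        rw [← withDensity_apply _ MeasurableSet.of_discrete]
        exact measure_mono hsub
    _ ≤ ENNReal.ofReal (2 / (2 - 1) * (N.toReal / t) ^ (2 - 1 : ℝ)) *
          levelSup (fun κ => (φ κ : ℝ)) :=
        setLIntegral_rpow_le_levelSup φ one_lt_two (by positivity)
    _ = 2 * levelSup (fun κ => (φ κ : ℝ)) * ENNReal.ofReal t⁻¹ * N := by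
        have hconst : 2 / (2 - 1) * (N.toReal / t) ^ (2 - 1 : ℝ) = 2 * (t⁻¹ * N.toReal) := by
          rw [show (2 - 1 : ℝ) = 1 by norm_num, Real.rpow_one, div_one, inv_mul_eq_div]
        rw [hconst, ENNReal.ofReal_mul two_pos.le, ENNReal.ofReal_mul (by positivity),
          ENNReal.ofReal_toReal hN_top, ENNReal.ofReal_ofNat]
        ring

theorem IsBesselMap.hasWeakType_two (hT : IsBesselMap μ T) (φ : ι → ℝ≥0) :
    HasWeakType (weightedQuotient T φ) 2 1 μ (paleyMeasure φ) := by
  refine HasWeakType.of_lintegral_rpow_le two_pos.le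
    (fun _ _ => Measurable.of_discrete.aemeasurable) fun f hf => ?_
  rw [ENNReal.ofReal_ofNat] at hf
  rw [lintegral_paleyMeasure, one_mul]
  exact (ENNReal.tsum_le_tsum (rpow_two_mul_enorm_weightedQuotient_le φ)).trans (hT.tsum_sq_le f hf)

end WeakType

/-- The constant in Paley's inequality, as the Marcinkiewicz interpolation theorem produces it.
The second summand blows up as `p → 2`, but vanishes at `p = 2` by the convention `x / 0 = 0`; there
Paley's inequality is Bessel's. -/
noncomputable def paleyConst (p : ℝ) : ℝ := 4 * p / (p - 1) + 4 * p / (2 - p)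

theorem one_le_paleyConst (hp : 1 < p) (hp2 : p ≤ 2) : 1 ≤ paleyConst p := by
  have hfirst : 1 ≤ 4 * p / (p - 1) := by
    rw [le_div_iff₀ (sub_pos.2 hp)]
    linarith
  have hsecond : 0 ≤ 4 * p / (2 - p) := div_nonneg (by linarith) (sub_nonneg.2 hp2)
  exact le_add_of_le_of_nonneg hfirst hsecond

variable [SFinite μ]

theorem IsBesselMap.paley_of_levelSup_le_one (hT : IsBesselMap μ T) {φ : ι → ℝ≥0}
    (hφ : levelSup (fun κ => (φ κ : ℝ)) ≤ 1) (hp : 1 < p) (hp2 : p < 2)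
    (hf : MemLp f (ENNReal.ofReal p) μ) :
    ∑' κ, (φ κ : ℝ≥0∞) ^ (2 - p) * ‖T f κ‖ₑ ^ p ≤
      ENNReal.ofReal (paleyConst p) * ∫⁻ x, ‖f x‖ₑ ^ p ∂μ := by
  let _ : MeasurableSpace ι := ⊤
  have hp0 : 0 ≤ p := zero_le_one.trans hp.le
  have _hp1 : 0 < p - 1 := sub_pos.2 hp
  have _hp2 : 0 < 2 - p := sub_pos.2 hp2
  calc ∑' κ, (φ κ : ℝ≥0∞) ^ (2 - p) * ‖T f κ‖ₑ ^ p
      = ∫⁻ κ, ‖weightedQuotient T φ f κ‖ₑ ^ p ∂paleyMeasure φ := by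
        simp_rw [lintegral_paleyMeasure, rpow_mul_enorm_weightedQuotient_rpow φ hp0 hp2]
    _ ≤ ENNReal.ofReal p *
          (2 * levelSup (fun κ => (φ κ : ℝ)) * ENNReal.ofReal (2 ^ (1 : ℝ) / (p - 1)) +
            1 * ENNReal.ofReal (2 ^ (2 : ℝ) / (2 - p))) * ∫⁻ x, ‖f x‖ₑ ^ p ∂μ := by
        refine (hT.hasWeakType_one φ).lintegral_rpow_le (hT.hasWeakType_two φ) one_pos hp hp2
          (fun g h hg hh => hT.weightedQuotient_add_le φ ?_ ?_) hf
          Measurable.of_discrete.aemeasurable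
        · simpa [memLp_one_iff_integrable] using hg
        · simpa using hh
    _ ≤ ENNReal.ofReal p * (2 * 1 * ENNReal.ofReal (2 ^ (1 : ℝ) / (p - 1)) +
          1 * ENNReal.ofReal (2 ^ (2 : ℝ) / (2 - p))) * ∫⁻ x, ‖f x‖ₑ ^ p ∂μ := by gcongr
    _ = ENNReal.ofReal (paleyConst p) * ∫⁻ x, ‖f x‖ₑ ^ p ∂μ := by
        rw [Real.rpow_one, Real.rpow_ofNat, mul_one, one_mul, ← ENNReal.ofReal_ofNat 2,
          ← ENNReal.ofReal_mul two_pos.le, ← ENNReal.ofReal_add (by positivity) (by positivity),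
          ← ENNReal.ofReal_mul hp0, paleyConst]
        congr 2
        ring

theorem IsBesselMap.paley (hT : IsBesselMap μ T) {φ : ι → ℝ≥0}
    (hφ : levelSup (fun κ => (φ κ : ℝ)) ≠ ∞) (hp : 1 < p) (hp2 : p ≤ 2)
    (hf : MemLp f (ENNReal.ofReal p) μ) :
    ∑' κ, (φ κ : ℝ≥0∞) ^ (2 - p) * ‖T f κ‖ₑ ^ p ≤
      ENNReal.ofReal (paleyConst p) * levelSup (fun κ => (φ κ : ℝ)) ^ (2 - p) *
        ∫⁻ x, ‖f x‖ₑ ^ p ∂μ := by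
  obtain rfl | hp2 := hp2.eq_or_lt
  · rw [ENNReal.ofReal_ofNat] at hf
    simp only [sub_self, ENNReal.rpow_zero, one_mul, mul_one]
    refine (hT.tsum_sq_le f hf).trans (le_mul_of_one_le_left zero_le ?_)
    exact ENNReal.one_le_ofReal.2 (one_le_paleyConst hp le_rfl)
  have hpos2 : 0 < 2 - p := sub_pos.2 hp2
  lift levelSup (fun κ => (φ κ : ℝ)) to ℝ≥0 using hφ with m hm
  obtain rfl | hm0 := eq_or_ne m 0
  · have hφ0 : ∀ κ, φ κ = 0 := fun κ => by
      simpa [← hm] using ofReal_le_levelSup (fun κ => (φ κ : ℝ)) κ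
    simp [hφ0, hpos2]
  have hψ : levelSup (fun κ => ((m⁻¹ * φ κ : ℝ≥0) : ℝ)) ≤ 1 := by
    simp only [NNReal.coe_mul]
    refine (levelSup_const_mul_le _ (NNReal.coe_pos.2 (inv_pos.2 hm0.bot_lt))).trans_eq ?_
    rw [← hm, ENNReal.ofReal_coe_nnreal, ← ENNReal.coe_mul, inv_mul_cancel₀ hm0, ENNReal.coe_one]
  calc ∑' κ, (φ κ : ℝ≥0∞) ^ (2 - p) * ‖T f κ‖ₑ ^ p
      = ∑' κ, (m : ℝ≥0∞) ^ (2 - p) * (((m⁻¹ * φ κ : ℝ≥0) : ℝ≥0∞) ^ (2 - p) * ‖T f κ‖ₑ ^ p) := by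
        congr 1 with κ
        rw [← mul_assoc, ← ENNReal.mul_rpow_of_nonneg _ _ hpos2.le, ← ENNReal.coe_mul,
          mul_inv_cancel_left₀ hm0]
    _ ≤ (m : ℝ≥0∞) ^ (2 - p) * (ENNReal.ofReal (paleyConst p) * ∫⁻ x, ‖f x‖ₑ ^ p ∂μ) := by
        rw [ENNReal.tsum_mul_left]
        gcongr
        exact hT.paley_of_levelSup_le_one hψ hp hp2 hf
    _ = _ := by ring

end Paley

section HausdorffYoungPaley

open LatticeFourier

variable {X ι E F : Type*} [MeasurableSpace X] [NormedAddCommGroup E] [SeminormedAddGroup F]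
  {μ : Measure X} [SFinite μ] {T : (X → E) → ι → F} {p p' : ℝ} {f : X → E}

theorem le_rpow_inv_of_le_rpow_one_sub_mul {a b : ℝ≥0∞} {s : ℝ} (hs : 0 < s) (ha : a ≠ ∞)
    (h : a ≤ a ^ (1 - s) * b) : a ≤ b ^ s⁻¹ := by
  obtain rfl | ha0 := eq_or_ne a 0
  · exact zero_le
  rw [ENNReal.le_rpow_inv_iff hs]
  calc a ^ s = a ^ (s - 1) * a := by
        nth_rw 3 [← ENNReal.rpow_one a]
        rw [← ENNReal.rpow_add _ _ ha0 ha, sub_add_cancel]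
    _ ≤ a ^ (s - 1) * (a ^ (1 - s) * b) := by gcongr
    _ = b := by
        rw [← mul_assoc, ← ENNReal.rpow_add _ _ ha0 ha, sub_add_sub_cancel, sub_self,
          ENNReal.rpow_zero, one_mul]

theorem IsBesselMap.hausdorffYoung (hT : IsBesselMap μ T) (hpp' : p.HolderConjugate p')
    (hp2 : p ≤ 2) (hf : MemLp f (ENNReal.ofReal p) μ) :
    ∑' κ, ‖T f κ‖ₑ ^ p' ≤
      (ENNReal.ofReal (paleyConst p) * ∫⁻ x, ‖f x‖ₑ ^ p ∂μ) ^ (p' / p) := by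
  classical
  have hconj : (p - 1) * p' = p := hpp'.sub_one_mul_conj
  have hp1 : 0 < p - 1 := hpp'.sub_one_pos
  have hp' : 0 < p' := hpp'.symm.pos
  have hexp : p' / p = (p - 1)⁻¹ := by
    rw [div_eq_iff hpp'.ne_zero, eq_inv_mul_iff_mul_eq₀ hp1.ne', hconj]
  rw [hexp, ENNReal.tsum_eq_iSup_sum]
  refine iSup_le fun S => ?_
  set Z : ℝ≥0∞ := ∑ κ ∈ S, ‖T f κ‖ₑ ^ p'
  have hZ : Z ≠ ∞ := ENNReal.sum_ne_top.2 fun κ _ => by finiteness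
  refine le_rpow_inv_of_le_rpow_one_sub_mul hp1 hZ ?_
  -- Paley's inequality with the weight `‖T f‖ ^ p'` itself, where `p' * (2 - p) + p = p'`.
  let ψ : ι → ℝ≥0 := fun κ => if κ ∈ S then ‖T f κ‖₊ ^ p' else 0
  have hψ : ∀ κ ∈ S, (ψ κ : ℝ≥0∞) = ‖T f κ‖ₑ ^ p' := fun κ hκ => by
    simp only [ψ, if_pos hκ, ENNReal.coe_rpow_of_nonneg _ hp'.le, enorm_eq_nnnorm]
  have hlevel : levelSup (fun κ => (ψ κ : ℝ)) ≤ Z := by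
    refine (levelSup_le_tsum ψ).trans_eq ?_
    rw [tsum_eq_sum (s := S) fun κ hκ => by simp [ψ, hκ], Finset.sum_congr rfl hψ]
  calc Z = ∑ κ ∈ S, (ψ κ : ℝ≥0∞) ^ (2 - p) * ‖T f κ‖ₑ ^ p :=
        Finset.sum_congr rfl fun κ hκ => by
          rw [hψ κ hκ, ← ENNReal.rpow_mul, ← ENNReal.rpow_add_of_nonneg _ _
            (mul_nonneg hp'.le (sub_nonneg.2 hp2)) hpp'.nonneg]
          congr 1
          linarith
    _ ≤ ∑' κ, (ψ κ : ℝ≥0∞) ^ (2 - p) * ‖T f κ‖ₑ ^ p := ENNReal.sum_le_tsum S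
    _ ≤ ENNReal.ofReal (paleyConst p) * levelSup (fun κ => (ψ κ : ℝ)) ^ (2 - p) *
          ∫⁻ x, ‖f x‖ₑ ^ p ∂μ :=
        hT.paley (hlevel.trans_lt hZ.lt_top).ne hpp'.lt hp2 hf
    _ ≤ ENNReal.ofReal (paleyConst p) * Z ^ (2 - p) * ∫⁻ x, ‖f x‖ₑ ^ p ∂μ := by
        gcongr
    _ = Z ^ (1 - (p - 1)) * (ENNReal.ofReal (paleyConst p) * ∫⁻ x, ‖f x‖ₑ ^ p ∂μ) := by
        rw [show 1 - (p - 1) = 2 - p by ring]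
        ring

theorem tsum_rpow_mul_rpow_le_rpow_tsum {u v : ι → ℝ≥0∞} {α β : ℝ} (hα : 0 ≤ α) (hβ : 0 ≤ β)
    (hαβ : α + β = 1) :
    ∑' κ, u κ ^ α * v κ ^ β ≤ (∑' κ, u κ) ^ α * (∑' κ, v κ) ^ β := by
  let _ : MeasurableSpace ι := ⊤
  simpa only [lintegral_count] using ENNReal.lintegral_mul_norm_pow_le (μ := Measure.count)
    (Measurable.of_discrete (f := u)).aemeasurable (Measurable.of_discrete (f := v)).aemeasurable
    hα hβ hαβ

/-- Interpolation by Hölder's inequality between Paley's inequality (`α = 1`) and the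
Hausdorff–Young inequality (`β = 1`). -/
theorem IsBesselMap.tsum_rpow_mul_rpow_le (hT : IsBesselMap μ T) (hpp' : p.HolderConjugate p')
    (hp2 : p ≤ 2) {α β : ℝ} (hα : 0 ≤ α) (hβ : 0 ≤ β) (hαβ : α + β = 1) {φ : ι → ℝ≥0}
    (hφ : levelSup (fun κ => (φ κ : ℝ)) ≠ ∞) (hf : MemLp f (ENNReal.ofReal p) μ) :
    ∑' κ, (φ κ : ℝ≥0∞) ^ (α * (2 - p)) * ‖T f κ‖ₑ ^ (α * p + β * p') ≤
      levelSup (fun κ => (φ κ : ℝ)) ^ (α * (2 - p)) *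
        (ENNReal.ofReal (paleyConst p) * ∫⁻ x, ‖f x‖ₑ ^ p ∂μ) ^ ((α * p + β * p') / p) := by
  set M := levelSup (fun κ => (φ κ : ℝ))
  set Y := ENNReal.ofReal (paleyConst p) * ∫⁻ x, ‖f x‖ₑ ^ p ∂μ with hY
  have hp : 0 < p := hpp'.pos
  have hp' : 0 < p' := hpp'.symm.pos
  have hpaley : ∑' κ, (φ κ : ℝ≥0∞) ^ (2 - p) * ‖T f κ‖ₑ ^ p ≤ M ^ (2 - p) * Y := by
    refine (hT.paley hφ hpp'.lt hp2 hf).trans_eq ?_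
    rw [hY]
    ring
  calc ∑' κ, (φ κ : ℝ≥0∞) ^ (α * (2 - p)) * ‖T f κ‖ₑ ^ (α * p + β * p')
      = ∑' κ, ((φ κ : ℝ≥0∞) ^ (2 - p) * ‖T f κ‖ₑ ^ p) ^ α * (‖T f κ‖ₑ ^ p') ^ β := by
        congr 1 with κ
        rw [ENNReal.mul_rpow_of_nonneg _ _ hα, ← ENNReal.rpow_mul, ← ENNReal.rpow_mul,
          ← ENNReal.rpow_mul, mul_assoc,
          ← ENNReal.rpow_add_of_nonneg _ _ (by positivity) (by positivity)]
        ring_nf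
    _ ≤ (∑' κ, (φ κ : ℝ≥0∞) ^ (2 - p) * ‖T f κ‖ₑ ^ p) ^ α * (∑' κ, ‖T f κ‖ₑ ^ p') ^ β :=
        tsum_rpow_mul_rpow_le_rpow_tsum hα hβ hαβ
    _ ≤ (M ^ (2 - p) * Y) ^ α * (Y ^ (p' / p)) ^ β := by
        gcongr
        exact hT.hausdorffYoung hpp' hp2 hf
    _ = M ^ (α * (2 - p)) * Y ^ ((α * p + β * p') / p) := by
        rw [ENNReal.mul_rpow_of_nonneg _ _ hα, ← ENNReal.rpow_mul, ← ENNReal.rpow_mul, mul_assoc,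
          ← ENNReal.rpow_add_of_nonneg _ _ (by positivity) (by positivity), mul_comm (2 - p)]
        congr 2
        field_simp

theorem IsBesselMap.hausdorffYoungPaley (hT : IsBesselMap μ T) (hpp' : p.HolderConjugate p')
    {b : ℝ} (hpb : p ≤ b) (hbp' : b ≤ p') {φ : ι → ℝ≥0}
    (hφ : levelSup (fun κ => (φ κ : ℝ)) ≠ ∞) (hf : MemLp f (ENNReal.ofReal p) μ) :
    (∑' κ, (‖T f κ‖ₑ * (φ κ : ℝ≥0∞) ^ (1 / b - 1 / p')) ^ b) ^ (1 / b) ≤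
      ENNReal.ofReal (paleyConst p) ^ (1 / p) *
        levelSup (fun κ => (φ κ : ℝ)) ^ (1 / b - 1 / p') * eLpNorm f (ENNReal.ofReal p) μ := by
  have hp : 0 < p := hpp'.pos
  have hp' : 0 < p' := hpp'.symm.pos
  have hconj : (p - 1) * p' = p := hpp'.sub_one_mul_conj
  have hp2 : p ≤ 2 := by nlinarith [hpb.trans hbp', hpp'.lt]
  have hb : 0 < b := hp.trans_le hpb
  have hmem : b ∈ segment ℝ p p' := by
    rw [segment_eq_Icc (hpb.trans hbp')]
    exact ⟨hpb, hbp'⟩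
  obtain ⟨α, β, hα, hβ, hαβ, rfl⟩ := hmem
  simp only [smul_eq_mul] at *
  set b := α * p + β * p' with hb_def
  have hexp : (1 / b - 1 / p') * b = α * (2 - p) := by
    field_simp
    linear_combination (-p') * hαβ + α * hconj - hb_def
  have hnorm : eLpNorm f (ENNReal.ofReal p) μ = (∫⁻ x, ‖f x‖ₑ ^ p ∂μ) ^ (1 / p) := by
    rw [eLpNorm_eq_lintegral_rpow_enorm_toReal (by simpa) ENNReal.ofReal_ne_top,
      ENNReal.toReal_ofReal hp.le]
  calc (∑' κ, (‖T f κ‖ₑ * (φ κ : ℝ≥0∞) ^ (1 / b - 1 / p')) ^ b) ^ (1 / b)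
      = (∑' κ, (φ κ : ℝ≥0∞) ^ (α * (2 - p)) * ‖T f κ‖ₑ ^ b) ^ (1 / b) := by
        simp_rw [ENNReal.mul_rpow_of_nonneg _ _ hb.le, ← ENNReal.rpow_mul, hexp, mul_comm]
    _ ≤ (levelSup (fun κ => (φ κ : ℝ)) ^ (α * (2 - p)) *
          (ENNReal.ofReal (paleyConst p) * ∫⁻ x, ‖f x‖ₑ ^ p ∂μ) ^ (b / p)) ^ (1 / b) := by
        gcongr
        exact hT.tsum_rpow_mul_rpow_le hpp' hp2 hα hβ hαβ hφ hf
    _ = levelSup (fun κ => (φ κ : ℝ)) ^ (1 / b - 1 / p') *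
          (ENNReal.ofReal (paleyConst p) * ∫⁻ x, ‖f x‖ₑ ^ p ∂μ) ^ (1 / p) := by
        rw [ENNReal.mul_rpow_of_nonneg _ _ (by positivity), ← ENNReal.rpow_mul, ← ENNReal.rpow_mul,
          ← hexp, mul_assoc, mul_one_div_cancel hb.ne', mul_one]
        congr 2
        field_simp
    _ = _ := by
        rw [hnorm, ENNReal.mul_rpow_of_nonneg _ _ (by positivity)]
        ring

end HausdorffYoungPaley


section Orthonormal

variable {X ι 𝕜 : Type*} [MeasurableSpace X] [RCLike 𝕜] {μ : Measure X} {e : ι → X → 𝕜}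

theorem inner_toLp_eq_integral {g h : X → 𝕜} (hg : MemLp g 2 μ) (hh : MemLp h 2 μ) :
    inner 𝕜 hg.toLp hh.toLp = ∫ x, h x * starRingEnd 𝕜 (g x) ∂μ := by
  rw [L2.inner_def]
  refine integral_congr_ae ?_
  filter_upwards [hg.coeFn_toLp, hh.coeFn_toLp] with x hgx hhx
  rw [hgx, hhx, RCLike.inner_apply]

theorem enorm_toLp_sq {h : X → 𝕜} (hh : MemLp h 2 μ) :
    ‖hh.toLp‖ₑ ^ 2 = ∫⁻ x, ‖h x‖ₑ ^ (2 : ℝ) ∂μ := by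
  rw [Lp.enorm_toLp, eLpNorm_eq_lintegral_rpow_enorm_toReal two_ne_zero ENNReal.ofNat_ne_top,
    ← ENNReal.rpow_natCast, ← ENNReal.rpow_mul]
  simp

theorem tsum_enorm_inner_sq_le {H : Type*} [SeminormedAddCommGroup H] [InnerProductSpace 𝕜 H]
    {v : ι → H} (hv : Orthonormal 𝕜 v) (x : H) : ∑' κ, ‖inner 𝕜 (v κ) x‖ₑ ^ 2 ≤ ‖x‖ₑ ^ 2 := by
  simp_rw [← ofReal_norm, ← ENNReal.ofReal_pow (norm_nonneg _)]
  rw [← ENNReal.ofReal_tsum_of_nonneg (fun _ => by positivity) (hv.inner_products_summable x)]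
  exact ENNReal.ofReal_le_ofReal (hv.tsum_inner_products_le x)

theorem IsBesselMap.of_orthonormal (he : ∀ κ, MemLp (e κ) 2 μ)
    (hbound : ∀ κ, ∀ᵐ x ∂μ, ‖e κ x‖ ≤ 1) (horth : Orthonormal 𝕜 fun κ => (he κ).toLp) :
    IsBesselMap μ fun (f : X → 𝕜) κ => ∫ x, f x * starRingEnd 𝕜 (e κ x) ∂μ where
  norm_map_add_le g h hg hh κ := by
    have hg_int : Integrable (fun x => g x * starRingEnd 𝕜 (e κ x)) μ :=
      hg.mul_bdd (c := 1) (he κ).star.1 (by simpa using hbound κ)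
    have hh_int : Integrable (fun x => h x * starRingEnd 𝕜 (e κ x)) μ :=
      hh.integrable_mul (he κ).star
    simp_rw [Pi.add_apply, add_mul]
    rw [integral_add hg_int hh_int]
    exact norm_add_le _ _
  enorm_le g _ κ := by
    refine (enorm_integral_le_lintegral_enorm _).trans (lintegral_mono_ae ?_)
    filter_upwards [hbound κ] with x hx
    rw [enorm_mul, RCLike.enorm_conj]
    exact mul_le_of_le_one_right zero_le (by rwa [← ofReal_norm, ENNReal.ofReal_le_one])
  tsum_sq_le h hh := by
    calc ∑' κ, ‖∫ x, h x * starRingEnd 𝕜 (e κ x) ∂μ‖ₑ ^ (2 : ℝ)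
        = ∑' κ, ‖inner 𝕜 (he κ).toLp hh.toLp‖ₑ ^ 2 := by
          simp_rw [inner_toLp_eq_integral, ENNReal.rpow_two]
      _ ≤ ‖hh.toLp‖ₑ ^ 2 := tsum_enorm_inner_sq_le horth _
      _ = ∫⁻ x, ‖h x‖ₑ ^ (2 : ℝ) ∂μ := enorm_toLp_sq hh

end Orthonormal

section Characters

open ProbabilityTheory

variable {G V : Type*} [AddGroup G] [Countable G] [AddCommGroup V] [MeasurableSpace V]
  [MeasurableAdd V] [AddAction G V] [MeasurableConstVAdd G V] [VAddCommClass V G V]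
  {μ : Measure V} [μ.IsAddLeftInvariant] [VAddInvariantMeasure G V μ] {Ω : Set V}

open scoped Pointwise in
theorem setIntegral_addChar_eq_zero (hΩ : IsAddFundamentalDomain G Ω μ) {χ : AddChar V Circle}
    (hχG : ∀ (g : G) x, χ (g +ᵥ x) = χ x) (hχ : χ ≠ 1) : ∫ x in Ω, (χ x : ℂ) ∂μ = 0 := by
  obtain ⟨y, hy⟩ := AddChar.ne_one_iff.1 hχ
  have hshift : ∫ x in Ω, (χ x : ℂ) ∂μ = χ y * ∫ x in Ω, (χ x : ℂ) ∂μ := by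
    calc ∫ x in Ω, (χ x : ℂ) ∂μ = ∫ x in y +ᵥ Ω, (χ x : ℂ) ∂μ :=
          hΩ.setIntegral_eq (hΩ.vadd_of_comm y) fun g x => by rw [hχG]
      _ = ∫ x in Ω, (χ (y + x) : ℂ) ∂μ :=
          (measurePreserving_add_left μ y).setIntegral_image_emb
            (measurableEmbedding_addLeft y) _ _
      _ = χ y * ∫ x in Ω, (χ x : ℂ) ∂μ := by
          simp_rw [AddChar.map_add_eq_mul, Circle.coe_mul, integral_const_mul]
  exact (mul_left_eq_self₀.1 hshift.symm).resolve_left (Circle.coe_eq_one.not.2 hy)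

theorem orthonormal_toLp_addChar (hΩ : IsAddFundamentalDomain G Ω μ)
    [IsProbabilityMeasure μ[|Ω]] {ι : Type*} {χ : ι → AddChar V Circle}
    (hinj : Function.Injective χ) (hχG : ∀ κ (g : G) x, χ κ (g +ᵥ x) = χ κ x)
    (hmem : ∀ κ, MemLp (fun x => (χ κ x : ℂ)) 2 μ[|Ω]) :
    Orthonormal ℂ fun κ => (hmem κ).toLp := by
  classical
  rw [orthonormal_iff_ite]
  intro κ κ'
  have hdiv : ∀ x, (χ κ' x : ℂ) * starRingEnd ℂ (χ κ x) = ((χ κ' - χ κ) x : Circle) := fun x => by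
    rw [AddChar.sub_apply', div_eq_mul_inv, Circle.coe_mul, Circle.coe_inv_eq_conj]
  rw [inner_toLp_eq_integral]
  simp_rw [hdiv]
  split_ifs with h
  · simp [h]
  · rw [ProbabilityTheory.cond, integral_smul_measure, setIntegral_addChar_eq_zero hΩ, smul_zero]
    · intro g x
      rw [AddChar.sub_apply', AddChar.sub_apply', hχG, hχG]
    · exact sub_ne_zero.2 fun h' => h (hinj h'.symm)

end Characters

namespace LatticeFourier

section InnerChar

variable {V : Type*} [NormedAddCommGroup V] [InnerProductSpace ℝ V]

/-- The character `x ↦ e^{2πi κ·x}`. -/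
noncomputable def innerChar (κ : V) : AddChar V Circle :=
  Real.fourierChar.compAddMonoidHom (innerₗ V κ).toAddMonoidHom

theorem innerChar_apply (κ x : V) : innerChar κ x = Real.fourierChar ⟪κ, x⟫_ℝ := rfl

theorem continuous_innerChar (κ : V) : Continuous (innerChar κ) :=
  Real.continuous_fourierChar.comp (innerSL ℝ κ).continuous

theorem innerChar_injective : Function.Injective (innerChar (V := V)) := fun _ _ h =>
  BoundedContinuousFunction.ext_of_char_eq (L := innerₗ V) Real.continuous_fourierChar
    Real.fourierChar_ne_one continuous_inner
    (fun v hv hv' => hv (inner_self_eq_zero.1 (LinearMap.congr_fun hv' v)))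
    fun w => congrArg ((↑) : Circle → ℂ) (DFunLike.congr_fun h w)

end InnerChar

section Lattice

open ProbabilityTheory

variable {d : ℕ} {L : Submodule ℤ (EuclideanSpace ℝ (Fin d))}
  {Ω : Set (EuclideanSpace ℝ (Fin d))} {κ : EuclideanSpace ℝ (Fin d)}

theorem innerChar_vadd (hκ : κ ∈ dualLattice L) (l : L) (x : EuclideanSpace ℝ (Fin d)) :
    innerChar κ (l +ᵥ x) = innerChar κ x := by
  obtain ⟨n, hn⟩ := mem_dualLattice.1 hκ l l.2
  have hl : innerChar κ (l : EuclideanSpace ℝ (Fin d)) = 1 := by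
    rw [innerChar_apply, ← hn, Real.fourierChar_apply', mul_comm, Circle.exp_int_mul_two_pi]
  rw [Submodule.vadd_def, vadd_eq_add, AddChar.map_add_eq_mul, hl, one_mul]

theorem coeff_eq_integral_innerChar (f : EuclideanSpace ℝ (Fin d) → ℂ)
    (κ : EuclideanSpace ℝ (Fin d)) :
    coeff Ω f κ = ∫ x, f x * starRingEnd ℂ (innerChar κ x) ∂volume[|Ω] := by
  have hconj : ∀ x, starRingEnd ℂ (innerChar κ x) =
      Complex.exp (-2 * Real.pi * Complex.I * ((⟪κ, x⟫_ℝ : ℝ) : ℂ)) := fun x => by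
    rw [innerChar_apply, Real.fourierChar_apply, ← Complex.exp_conj]
    congr 1
    simp only [map_mul, Complex.conj_ofReal, Complex.conj_I]
    push_cast
    ring
  simp_rw [hconj]
  rw [ProbabilityTheory.cond, integral_smul_measure, ENNReal.toReal_inv, Complex.real_smul,
    Complex.ofReal_inv, coeff, Measure.real]

theorem IsLatticeFundamentalDomain.isAddFundamentalDomain (hΩ : IsLatticeFundamentalDomain L Ω) :
    IsAddFundamentalDomain L Ω volume :=
  IsAddFundamentalDomain.mk' hΩ.measurable fun x => by
    simpa only [Submodule.vadd_def, vadd_eq_add, add_comm] using hΩ.existsUnique_add_mem x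

variable [DiscreteTopology L] [IsZLattice ℝ L]

theorem IsLatticeFundamentalDomain.volume_real_ne_zero (hΩ : IsLatticeFundamentalDomain L Ω) :
    volume.real Ω ≠ 0 := by
  rw [← ZLattice.covolume_eq_measure_fundamentalDomain L volume hΩ.isAddFundamentalDomain]
  exact ZLattice.covolume_ne_zero L volume

theorem IsLatticeFundamentalDomain.volume_ne_zero (hΩ : IsLatticeFundamentalDomain L Ω) :
    volume Ω ≠ 0 := fun h => hΩ.volume_real_ne_zero (by simp [Measure.real, h])

theorem IsLatticeFundamentalDomain.isProbabilityMeasure_cond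
    (hΩ : IsLatticeFundamentalDomain L Ω) : IsProbabilityMeasure (volume[|Ω]) :=
  cond_isProbabilityMeasure_of_finite hΩ.volume_ne_zero fun h =>
    hΩ.volume_real_ne_zero (by simp [Measure.real, h])

theorem IsLatticeFundamentalDomain.isBesselMap_coeff (hΩ : IsLatticeFundamentalDomain L Ω) :
    IsBesselMap (volume[|Ω]) fun f (κ : dualLattice L) => coeff Ω f κ := by
  have := hΩ.isProbabilityMeasure_cond
  have : VAddInvariantMeasure L (EuclideanSpace ℝ (Fin d)) volume :=
    inferInstanceAs <| VAddInvariantMeasure L.toAddSubgroup (EuclideanSpace ℝ (Fin d)) volume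
  have hbound : ∀ κ : dualLattice L, ∀ᵐ x ∂volume[|Ω],
      ‖(innerChar (κ : EuclideanSpace ℝ (Fin d)) x : ℂ)‖ ≤ 1 := fun κ =>
    Filter.Eventually.of_forall fun x => (Circle.norm_coe _).le
  have hmem : ∀ κ : dualLattice L,
      MemLp (fun x => (innerChar (κ : EuclideanSpace ℝ (Fin d)) x : ℂ)) 2 (volume[|Ω]) := fun κ =>
    .of_bound (continuous_subtype_val.comp (continuous_innerChar _)).aestronglyMeasurable 1
      (hbound κ)
  simp_rw [coeff_eq_integral_innerChar]
  exact .of_orthonormal hmem hbound <| orthonormal_toLp_addChar hΩ.isAddFundamentalDomain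
    (innerChar_injective.comp Subtype.val_injective) (fun κ => innerChar_vadd κ.2) hmem

end Lattice

end LatticeFourier

theorem mainTheorem3 (p p' b : ℝ) (hp : 1 < p) (hp2 : p ≤ 2) (hpp' : 1 / p + 1 / p' = 1)
    (hpb : p ≤ b) (hbp' : b ≤ p') :
    ∃ C : ℝ≥0, 0 < C ∧
      ∀ (d : ℕ) (L : Submodule ℤ (EuclideanSpace ℝ (Fin d))) [DiscreteTopology L] [IsZLattice ℝ L]
        (Ω : Set (EuclideanSpace ℝ (Fin d))), LatticeFourier.IsLatticeFundamentalDomain L Ω →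
      ∀ φ : LatticeFourier.dualLattice L → ℝ, (∀ κ, 0 < φ κ) → LatticeFourier.levelSup φ < ∞ →
      ∀ f : EuclideanSpace ℝ (Fin d) → ℂ, MemLp f (ENNReal.ofReal p) (volume.restrict Ω) →
        (∑' κ : LatticeFourier.dualLattice L,
            ‖LatticeFourier.coeff Ω f κ * ((φ κ ^ (1 / b - 1 / p') : ℝ) : ℂ)‖ₑ ^ b) ^ (1 / b) ≤
          C * LatticeFourier.levelSup φ ^ (1 / b - 1 / p') * LatticeFourier.normLp Ω p f := by
  have hconj : p.HolderConjugate p' := Real.holderConjugate_iff.2 ⟨hp, by simpa using hpp'⟩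
  have hb : 0 < b := hconj.pos.trans_le hpb
  have hexp : 0 ≤ 1 / b - 1 / p' := sub_nonneg.2 (one_div_le_one_div_of_le hb hbp')
  have hC : 0 < paleyConst p := zero_lt_one.trans_le (one_le_paleyConst hp hp2)
  refine ⟨(paleyConst p).toNNReal ^ (1 / p), NNReal.rpow_pos (Real.toNNReal_pos.2 hC), ?_⟩
  intro d L _ _ Ω hΩ φ hφ hlevel f hf
  have := hΩ.isProbabilityMeasure_cond
  lift φ to LatticeFourier.dualLattice L → ℝ≥0 using fun κ => (hφ κ).le
  have hweight : ∀ κ, ‖((φ κ ^ (1 / b - 1 / p') : ℝ) : ℂ)‖ₑ =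
      (φ κ : ℝ≥0∞) ^ (1 / b - 1 / p') := fun κ => by
    rw [enorm_eq_nnnorm, Complex.nnnorm_real, ← NNReal.coe_rpow, NNReal.nnnorm_eq,
      ENNReal.coe_rpow_of_nonneg _ hexp]
  simp_rw [enorm_mul, hweight, ENNReal.coe_rpow_of_nonneg _ (one_div_nonneg.2 hconj.nonneg)]
  exact hΩ.isBesselMap_coeff.hausdorffYoungPaley hconj hpb hbp' hlevel.ne
    (hf.smul_measure (ENNReal.inv_ne_top.2 hΩ.volume_ne_zero))
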